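/- Let $N\ge 1$ and let $\gamma_1,\dots,\gamma_N\in\mathbb R$ satisfy $$\Bigl|\sum_{n=K}^{N}\gamma_n\Bigr|<1\quad(1\le K\le N),\qquad \sum_{n=K}^{M}\gamma_n\neq 0\quad(2\le K\le M\le N).$$ For $E>0$ consider the stationary system for $w=(w_1,\dots,w_N)\in\mathbb C^N$ $$E w_n=w_{n+1}+w_{n-1}+i\gamma_n w_n+|w_n|^2w_n,\quad 1\le n\le N,\qquad w_0=\overline{w_1},\quad w_{N+1}=0 .$$ For $1\le M\le N$ say that $M$ is admissible if $\bigl|\sum_{n=K}^{M}\gamma_n\bigr|<1$ for all $1\le K\le M$ (so $M=N$ is admissible). Say that $w$ has profile $M$ with constant $C$ if $\bigl||w_n|^2-E\bigr|\le C$ for $1\le n\le M$ and $|w_n|^2\le C/E$ for $M<n\le N$. Two vectors are gauge equivalent if they differ by a factor $c\in\mathbb C$ with $|c|=1$. Then there are constants $E_0,C>0$ and, for each admissible $M$, $2^M$ branches $E\mapsto w^{(M,j)}(E)$, $1\le j\le 2^M$, which for $E\in(E_0,\infty)$ are $C^\infty$, solve the stationary system, have profile $M$ with constant $C$, and are pairwise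 not gauge equivalent at each $E>E_0$, such that there are no other nonzero solutions, in the following sense. For every $E>E_0$ and every nonzero solution $w$ of the stationary system at $E$ there is $M\in\{1,\dots,N\}$ such that - $w$ has profile $M$ with constant $C$ (the large-amplitude sites are grouped at the center); - $\bigl|\sum_{n=K}^{M}\gamma_n\bigr|\le 1$ for all $1\le K\le M$; - if $M$ is admissible, then $w$ is gauge equivalent to $w^{(M,j)}(E)$ for some $j$. In particular, if no sum $\sum_{n=K}^{M}\gamma_n$ with $1\le K\le M<N$ equals $\pm1$, then every nonzero solution at every $E>E_0$ is gauge equivalent to one of the $w^{(M,j)}(E)$ with $M$ admissible. -/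

import Mathlib

open scoped ContDiff ComplexConjugate

/-- `w` solves the stationary PT-invariant system on sites `1, …, N` at energy `E`:
`E w_n = w_{n+1} + w_{n-1} + i γ_n w_n + |w_n|² w_n` for `1 ≤ n ≤ N`, with the boundary
conditions `w_0 = conj w_1` (PT-invariance across the center) and `w_{N+1} = 0`.
A vector in `ℂ^N` is represented by a sequence on `ℕ` that vanishes beyond `N`. -/
def IsStationaryMode (N : ℕ) (γ : ℕ → ℝ) (E : ℝ) (w : ℕ → ℂ) : Prop :=
  w 0 = conj (w 1) ∧ (∀ n, N < n → w n = 0) ∧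
    ∀ n, 1 ≤ n → n ≤ N →
      (E : ℂ) * w n = w (n + 1) + w (n - 1) + Complex.I * (γ n : ℂ) * w n
        + ((‖w n‖ ^ 2 : ℝ) : ℂ) * w n

/-- Two vectors on sites `1, …, N` agree up to a gauge factor of modulus one. -/
def GaugeEquiv (N : ℕ) (v w : ℕ → ℂ) : Prop :=
  ∃ c : ℂ, ‖c‖ = 1 ∧ ∀ n, 1 ≤ n → n ≤ N → v n = c * w n

/-- Exactly the sites `1, …, M` closest to the center are large: `||w_n|² - E| ≤ C` for
`1 ≤ n ≤ M`, and `|w_n|² ≤ C / E` for `M < n ≤ N`. -/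
def HasProfile (N M : ℕ) (C E : ℝ) (w : ℕ → ℂ) : Prop :=
  (∀ n, 1 ≤ n → n ≤ M → |‖w n‖ ^ 2 - E| ≤ C) ∧
    ∀ n, M < n → n ≤ N → ‖w n‖ ^ 2 ≤ C / E

/-- The phase equations of the block `1, …, M` are nondegenerate:
`|γ_K + ⋯ + γ_M| < 1` for each `1 ≤ K ≤ M`. -/
def PhaseCondition (γ : ℕ → ℝ) (M : ℕ) : Prop :=
  ∀ K, 1 ≤ K → K ≤ M → |∑ n ∈ Finset.Icc K M, γ n| < 1

/-- The `2^M` branches of stationary solutions, `C^∞` in `E ∈ (E₀, ∞)` and pairwise distinct up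
to gauge, whose large sites are `1, …, M`. -/
structure IsBranchSystem (N : ℕ) (γ : ℕ → ℝ) (M : ℕ) (E₀ C : ℝ)
    (u : Fin (2 ^ M) → ℝ → ℕ → ℂ) : Prop where
  stationary : ∀ j E, E₀ < E → IsStationaryMode N γ E (u j E)
  smooth : ∀ j n, ContDiffOn ℝ ∞ (fun E => u j E n) (Set.Ioi E₀)
  profile : ∀ j E, E₀ < E → HasProfile N M C E (u j E)
  distinct : ∀ j k, j ≠ k → ∀ E, E₀ < E → ¬ GaugeEquiv N (u j E) (u k E)

/-! Put J_n = Im(conj w_n * w_{n+1}); then J_{n-1} = J_n + γ_n |w_n|². For large E each |w_n|² is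
either within O(1) of E or O(1/E), and a bond with a small end carries bounded flux. A run of large
sites starting just after a small site would therefore keep E |∑ γ_n| over the run bounded, which
nonvanishing of the sums forbids for large E. Hence the large sites are 1, …, M
(`IsStationaryMode.exists_profile`), and |J_{K-1}| ≤ E + O(1) forces the sums from K to M to be at
most 1 in modulus.

To find all solutions with a given M, scale w = √E x, ε = 1/E. At ε = 0 the site equations leave the
phases of the large sites free, so the implicit function theorem does not apply to them. The
imaginary part of conj x_n times the site equation is, however, ε times the flux balance. Dividing
by ε and summing gives `reducedSystem`, which has the same zeros for ε ≠ 0 as long as x_1, …, x_M do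
not vanish, and which determines the phases at ε = 0.

In the limit, conj z_{n-1} * z_n is a unit number with imaginary part γ_n + ⋯ + γ_M. Strict
inequality in the phase condition gives two choices per site, and the center condition fixes the
remaining phase up to sign: 2^M modes up to sign (`exists_limitModes`). The linearization there is
injective (`eq_zero_of_reducedLinearization`), so each limit mode continues to a branch; compactness
excludes other solutions (`eventually_mem_branch`). -/

/-! ### Flux identity and a priori bounds -/

/-- Multiplying the stationary equation at one site by the conjugate amplitude and taking
imaginary parts gives the balance of the flux `Im (conj w_n * w_{n+1})`. -/
lemma flux_balance {E g r : ℝ} {a b c : ℂ}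
    (h : (E : ℂ) * b = c + a + Complex.I * (g : ℂ) * b + (r : ℂ) * b) :
    (conj a * b).im = (conj b * c).im + g * ‖b‖ ^ 2 := by
  have h1 := congrArg Complex.re h
  have h2 := congrArg Complex.im h
  rw [← Complex.normSq_eq_norm_sq, Complex.normSq_apply]
  simp at h1 h2 ⊢
  linear_combination b.re * h2 - b.im * h1

lemma flux_sum {J a γ : ℕ → ℝ} {L M : ℕ} (hLM : L ≤ M)
    (h : ∀ n, L < n → n ≤ M → J (n - 1) = J n + γ n * a n) :
    J L = J M + ∑ n ∈ Finset.Icc (L + 1) M, γ n * a n := by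
  induction M, hLM using Nat.le_induction with
  | base => simp
  | succ M hM ih =>
    rw [Finset.sum_Icc_succ_top (by omega), ih fun n h1 h2 => h n h1 (by omega)]
    have := h (M + 1) (by omega) le_rfl
    simp only [Nat.add_sub_cancel] at this
    rw [this]; ring

lemma abs_im_conj_mul_le (a b : ℂ) : |(conj a * b).im| ≤ ‖a‖ * ‖b‖ := by
  simpa using Complex.abs_im_le_norm (conj a * b)

namespace IsStationaryMode

variable {N : ℕ} {γ : ℕ → ℝ} {E : ℝ} {w : ℕ → ℂ}

lemma flux_eq (h : IsStationaryMode N γ E w) {L M : ℕ} (hLM : L ≤ M) (hM : M ≤ N) :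
    (conj (w L) * w (L + 1)).im = (conj (w M) * w (M + 1)).im
      + ∑ n ∈ Finset.Icc (L + 1) M, γ n * ‖w n‖ ^ 2 := by
  refine flux_sum (J := fun n => (conj (w n) * w (n + 1)).im) (a := fun n => ‖w n‖ ^ 2) hLM ?_
  intro n h1 h2
  have := flux_balance (h.2.2 n (by omega) (by omega))
  rwa [show n - 1 + 1 = n by omega]

/-- The gain term is imaginary while |w_n|² - E is real, so discarding it only lowers the modulus.
The bounds on amplitudes derived from this are thus independent of γ. -/
lemma abs_sub_mul_norm_le (h : IsStationaryMode N γ E w) {n : ℕ} (h1 : 1 ≤ n) (h2 : n ≤ N) :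
    |‖w n‖ ^ 2 - E| * ‖w n‖ ≤ ‖w (n + 1)‖ + ‖w (n - 1)‖ := by
  have e := h.2.2 n h1 h2
  have e' : ((‖w n‖ ^ 2 - E : ℝ) + Complex.I * (γ n : ℂ)) * w n = -(w (n + 1) + w (n - 1)) := by
    push_cast at e ⊢
    linear_combination -e
  have l : |‖w n‖ ^ 2 - E| ≤ ‖((‖w n‖ ^ 2 - E : ℝ) : ℂ) + Complex.I * (γ n : ℂ)‖ := by
    have := Complex.abs_re_le_norm (((‖w n‖ ^ 2 - E : ℝ) : ℂ) + Complex.I * (γ n : ℂ))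
    rwa [Complex.add_re, Complex.ofReal_re, Complex.mul_re, Complex.I_re, Complex.ofReal_im,
      zero_mul, mul_zero, sub_zero, add_zero] at this
  calc _ ≤ ‖((‖w n‖ ^ 2 - E : ℝ) : ℂ) + Complex.I * (γ n : ℂ)‖ * ‖w n‖ := by gcongr
    _ = ‖w (n + 1) + w (n - 1)‖ := by rw [← norm_mul, e', norm_neg]
    _ ≤ _ := norm_add_le _ _

/-- The amplitude is maximal at some site, where it is close to `E`. -/
lemma exists_max (h : IsStationaryMode N γ E w) (h0 : w ≠ 0) :
    ∃ m, 1 ≤ m ∧ m ≤ N ∧ (∀ n, ‖w n‖ ≤ ‖w m‖) ∧ |‖w m‖ ^ 2 - E| ≤ 2 := by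
  have hN : 1 ≤ N := by
    by_contra hN
    apply h0
    funext n
    rcases Nat.eq_zero_or_pos n with rfl | hn
    · simp [h.1, h.2.1 1 (by omega)]
    · exact h.2.1 n (by omega)
  obtain ⟨m, hm, hmax⟩ := Finset.exists_max_image (Finset.Icc 1 N) (fun n => ‖w n‖) ⟨1, by simp [hN]⟩
  rw [Finset.mem_Icc] at hm
  have hle : ∀ n, ‖w n‖ ≤ ‖w m‖ := by
    intro n
    rcases Nat.eq_zero_or_pos n with rfl | hn
    · rw [h.1, Complex.norm_conj]
      exact hmax 1 (by simp [hN])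
    · by_cases hn' : n ≤ N
      · exact hmax n (by simp; omega)
      · simp [h.2.1 n (by omega)]
  refine ⟨m, hm.1, hm.2, hle, ?_⟩
  have hpos : 0 < ‖w m‖ := by
    obtain ⟨k, hk⟩ := Function.ne_iff.1 h0
    exact (norm_pos_iff.2 hk).trans_le (hle k)
  have := h.abs_sub_mul_norm_le hm.1 hm.2
  have := hle (m + 1)
  have := hle (m - 1)
  refine le_of_mul_le_mul_right (a := ‖w m‖) ?_ hpos
  linarith

lemma normSq_le (h : IsStationaryMode N γ E w) (hE : 2 ≤ E) (n : ℕ) : ‖w n‖ ^ 2 ≤ E + 2 := by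
  by_cases h0 : w = 0
  · simp [h0]; linarith
  · obtain ⟨m, -, -, hle, hm⟩ := h.exists_max h0
    have := (abs_le.1 hm).2
    have : ‖w n‖ ^ 2 ≤ ‖w m‖ ^ 2 := by gcongr; exact hle n
    linarith

/-- Squaring the site bound gives r (r - E)² ≤ 4 (E + 2) for r = |w_n|², which confines r to a
neighbourhood of E or of 0. -/
lemma large_or_small (h : IsStationaryMode N γ E w) (hE : 2 ≤ E) {n : ℕ} (h1 : 1 ≤ n)
    (h2 : n ≤ N) : |‖w n‖ ^ 2 - E| ≤ 4 ∨ ‖w n‖ ^ 2 ≤ 32 / E := by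
  have key : ‖w n‖ ^ 2 * (‖w n‖ ^ 2 - E) ^ 2 ≤ 4 * (E + 2) := by
    have a := h.abs_sub_mul_norm_le h1 h2
    have b1 := h.normSq_le hE (n + 1)
    have b2 := h.normSq_le hE (n - 1)
    calc ‖w n‖ ^ 2 * (‖w n‖ ^ 2 - E) ^ 2 = (|‖w n‖ ^ 2 - E| * ‖w n‖) ^ 2 := by
          rw [mul_pow, sq_abs]; ring
      _ ≤ (‖w (n + 1)‖ + ‖w (n - 1)‖) ^ 2 := by gcongr
      _ ≤ _ := by nlinarith [sq_nonneg (‖w (n + 1)‖ - ‖w (n - 1)‖)]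
  have hr : 0 ≤ ‖w n‖ ^ 2 := by positivity
  generalize ‖w n‖ ^ 2 = r at key hr
  by_cases hc : E / 2 ≤ r
  · left
    apply abs_le_of_sq_le_sq _ (by norm_num)
    -- Here (r - E)² ≤ 8 (E + 2) / E ≤ 16, by E ≥ 2.
    have : E / 2 * (r - E) ^ 2 ≤ r * (r - E) ^ 2 := by gcongr
    by_contra! hlt
    nlinarith
  · right
    push Not at hc
    rw [le_div_iff₀ (by linarith)]
    have : (E / 2) ^ 2 ≤ (r - E) ^ 2 := by nlinarith
    have : r * (E / 2) ^ 2 ≤ r * (r - E) ^ 2 := by gcongr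
    have : E * (r * E) ≤ E * 32 := by nlinarith
    exact le_of_mul_le_mul_left this (by linarith)

/-- The flux through a bond between a small and an arbitrary site is bounded. -/
lemma abs_flux_le (h : IsStationaryMode N γ E w) (hE : 2 ≤ E) {m n : ℕ}
    (hm : ‖w m‖ ^ 2 ≤ 32 / E) : ‖w m‖ * ‖w n‖ ≤ 8 := by
  apply le_of_sq_le_sq _ (by norm_num)
  have hn := h.normSq_le hE n
  calc (‖w m‖ * ‖w n‖) ^ 2 = ‖w m‖ ^ 2 * ‖w n‖ ^ 2 := by ring
    _ ≤ 32 / E * (E + 2) := by gcongr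
    _ = 32 + 64 / E := by field_simp; ring
    _ ≤ 32 + 64 / 2 := by gcongr
    _ = 8 ^ 2 := by norm_num

/-- On a block of large sites the flux difference is `E` times the sum of the gains. -/
lemma abs_sum_sub_le {K M : ℕ} (hK : 1 ≤ K) (hM : M ≤ N)
    (hl : ∀ n, K ≤ n → n ≤ M → |‖w n‖ ^ 2 - E| ≤ 4) :
    |∑ n ∈ Finset.Icc K M, γ n * ‖w n‖ ^ 2 - E * ∑ n ∈ Finset.Icc K M, γ n|
      ≤ 4 * ∑ n ∈ Finset.Icc 1 N, |γ n| := by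
  rw [Finset.mul_sum, ← Finset.sum_sub_distrib, Finset.mul_sum]
  calc _ ≤ ∑ n ∈ Finset.Icc K M, |γ n * ‖w n‖ ^ 2 - E * γ n| := Finset.abs_sum_le_sum_abs _ _
    _ ≤ ∑ n ∈ Finset.Icc K M, 4 * |γ n| := by
      refine Finset.sum_le_sum fun n hn => ?_
      rw [Finset.mem_Icc] at hn
      rw [show γ n * ‖w n‖ ^ 2 - E * γ n = (‖w n‖ ^ 2 - E) * γ n by ring, abs_mul]
      gcongr
      exact hl n hn.1 hn.2
    _ ≤ _ := by
      refine Finset.sum_le_sum_of_subset_of_nonneg ?_ fun _ _ _ => by positivity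
      exact Finset.Icc_subset_Icc hK hM

/-- For large `E` the large sites of a nonzero mode are exactly `1, …, M` for some `M`. -/
theorem exists_profile (h : IsStationaryMode N γ E w) (h0 : w ≠ 0) (hE : 2 ≤ E)
    (hne : ∀ K M, 2 ≤ K → K ≤ M → M ≤ N →
      16 + 4 * ∑ n ∈ Finset.Icc 1 N, |γ n| < E * |∑ n ∈ Finset.Icc K M, γ n|)
    (hone : ∀ K M, 1 ≤ K → K ≤ M → M ≤ N → 1 < |∑ n ∈ Finset.Icc K M, γ n| →
      E + 10 + 4 * ∑ n ∈ Finset.Icc 1 N, |γ n| < E * |∑ n ∈ Finset.Icc K M, γ n|) :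
    ∃ M, 1 ≤ M ∧ M ≤ N ∧ HasProfile N M 32 E w ∧
      ∀ K, 1 ≤ K → K ≤ M → |∑ n ∈ Finset.Icc K M, γ n| ≤ 1 := by
  set S := ∑ n ∈ Finset.Icc 1 N, |γ n|
  let P : ℕ → Prop := fun n => 1 ≤ n ∧ n ≤ N ∧ |‖w n‖ ^ 2 - E| ≤ 4
  have hsmall : ∀ n, 1 ≤ n → ¬ P n → ‖w n‖ ^ 2 ≤ 32 / E := by
    intro n h1 hP
    by_cases hn : n ≤ N
    · exact (h.large_or_small hE h1 hn).resolve_left fun hc => hP ⟨h1, hn, hc⟩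
    · rw [h.2.1 n (by omega)]; simp; positivity
  have hright : ∀ M, ¬ P (M + 1) → |(conj (w M) * w (M + 1)).im| ≤ 8 := fun M hM => by
    refine (abs_im_conj_mul_le _ _).trans ?_
    rw [mul_comm]
    exact h.abs_flux_le hE (hsmall _ (by omega) hM)
  have hdown : ∀ L, 1 ≤ L → P (L + 1) → P L := by
    intro L hL hP
    by_contra hnP
    classical
    -- Site N + 1 is never large, so the run of large sites starting at L + 1 ends at some M ≤ N,
    -- with small sites on both sides.
    have hex : ∃ n, L + 1 < n ∧ ¬ P n := ⟨N + 1, by have := hP.2.1; omega, fun hc => by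
      have := hc.2.1; omega⟩
    obtain ⟨hf1, hf2⟩ := Nat.find_spec hex
    have hmin := fun m => Nat.find_min (H := hex) (m := m)
    generalize Nat.find hex = f at hf1 hf2 hmin
    obtain ⟨M, rfl⟩ : ∃ M, f = M + 1 := ⟨f - 1, by omega⟩
    have hPs : ∀ n, L + 1 ≤ n → n ≤ M → P n := by
      intro n h1 h2
      rcases h1.eq_or_lt with rfl | h1
      · exact hP
      · by_contra hc
        exact hmin n (by omega) ⟨h1, hc⟩
    have hMN : M ≤ N := (hPs M (by omega) le_rfl).2.1
    have e := h.flux_eq (L := L) (M := M) (by omega) hMN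
    have b1 := hright M hf2
    have b2 : |(conj (w L) * w (L + 1)).im| ≤ 8 :=
      (abs_im_conj_mul_le _ _).trans (h.abs_flux_le hE (hsmall L hL hnP))
    have b3 := abs_sum_sub_le (N := N) (γ := γ) (E := E) (w := w) (K := L + 1) (M := M)
      (by omega) hMN fun n h1 h2 => (hPs n h1 h2).2.2
    -- L ≥ 1 makes the lower index at least 2, the range in which the sums are bounded away from
    -- zero.
    have b4 := hne (L + 1) M (by omega) (by omega) hMN
    rw [← abs_of_pos (show 0 < E by linarith), ← abs_mul] at b4
    rw [abs_le] at b1 b2 b3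
    have : |E * ∑ n ∈ Finset.Icc (L + 1) M, γ n| ≤ 16 + 4 * S := by
      rw [abs_le]; constructor <;> linarith [b1.1, b1.2, b2.1, b2.2, b3.1, b3.2]
    linarith
  obtain ⟨m, hm1, hm2, -, hm3⟩ := h.exists_max h0
  have hPm : P m := ⟨hm1, hm2, by linarith⟩
  classical
  have hPM : P (Nat.findGreatest P N) := Nat.findGreatest_spec hm2 hPm
  have hgr : ∀ n, Nat.findGreatest P N < n → ¬ P n := fun n hn hc =>
    Nat.findGreatest_is_greatest hn hc.2.1 hc
  generalize Nat.findGreatest P N = M at hPM hgr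
  have hall : ∀ n, 1 ≤ n → n ≤ M → P n := by
    intro n h1 h2
    revert h1
    induction h2 using Nat.decreasingInduction with
    | self => exact fun _ => hPM
    | of_succ k hk ih => exact fun h1 => hdown k h1 (ih (by omega))
  refine ⟨M, hPM.1, hPM.2.1, ⟨fun n h1 h2 => (hall n h1 h2).2.2.trans (by norm_num),
    fun n h1 h2 => hsmall n (by omega) (hgr n h1)⟩, fun K h1 h2 => ?_⟩
  by_contra! hc
  obtain ⟨L, rfl⟩ : ∃ L, K = L + 1 := ⟨K - 1, by omega⟩
  have e := h.flux_eq (L := L) (M := M) (by omega) hPM.2.1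
  have b1 := hright M (hgr _ (by omega))
  -- Site L may be large or the reflected site 0, so only the arithmetic-geometric mean bound is
  -- available.
  have b2 : |(conj (w L) * w (L + 1)).im| ≤ E + 2 := by
    refine (abs_im_conj_mul_le _ _).trans ?_
    nlinarith [h.normSq_le hE L, h.normSq_le hE (L + 1), sq_nonneg (‖w L‖ - ‖w (L + 1)‖)]
  have b3 := abs_sum_sub_le (N := N) (γ := γ) (E := E) (w := w) (K := L + 1) (M := M)
    (by omega) hPM.2.1 fun n h1 h2 => (hall n (by omega) h2).2.2
  have b4 := hone (L + 1) M (by omega) (by omega) hPM.2.1 hc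
  rw [← abs_of_pos (show 0 < E by linarith), ← abs_mul, abs_of_pos (show 0 < E by linarith)] at b4
  rw [abs_le] at b1 b2 b3
  have : |E * ∑ n ∈ Finset.Icc (L + 1) M, γ n| ≤ E + 10 + 4 * S := by
    rw [abs_le]; constructor <;> linarith [b1.1, b1.2, b2.1, b2.2, b3.1, b3.2]
  linarith

end IsStationaryMode

/-- The two largeness conditions of `IsStationaryMode.exists_profile` hold eventually. -/
lemma eventually_gap {N : ℕ} {γ : ℕ → ℝ}
    (hγ' : ∀ M K, 2 ≤ K → K ≤ M → M ≤ N → ∑ n ∈ Finset.Icc K M, γ n ≠ 0) (A B : ℝ) :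
    ∀ᶠ E in Filter.atTop,
      (∀ K M, 2 ≤ K → K ≤ M → M ≤ N → A < E * |∑ n ∈ Finset.Icc K M, γ n|) ∧
      (∀ K M, 1 ≤ K → K ≤ M → M ≤ N → 1 < |∑ n ∈ Finset.Icc K M, γ n| →
        E + B < E * |∑ n ∈ Finset.Icc K M, γ n|) := by
  have key : ∀ p ∈ Finset.range (N + 1) ×ˢ Finset.range (N + 1), ∀ᶠ E in Filter.atTop,
      (2 ≤ p.1 → p.1 ≤ p.2 → A < E * |∑ n ∈ Finset.Icc p.1 p.2, γ n|) ∧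
      (1 < |∑ n ∈ Finset.Icc p.1 p.2, γ n| → E + B < E * |∑ n ∈ Finset.Icc p.1 p.2, γ n|) := by
    rintro ⟨K, M⟩ hp
    simp only [Finset.mem_product, Finset.mem_range] at hp
    refine Filter.Eventually.and ?_ ?_
    · by_cases hc : 2 ≤ K ∧ K ≤ M
      · have := (Filter.tendsto_id (α := ℝ)).atTop_mul_const
          (abs_pos.2 (hγ' M K hc.1 hc.2 (by omega)))
        filter_upwards [this.eventually_gt_atTop A] with E hE _ _ using hE
      · exact Filter.Eventually.of_forall fun E h1 h2 => absurd ⟨h1, h2⟩ hc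
    · by_cases hc : 1 < |∑ n ∈ Finset.Icc K M, γ n|
      · have := (Filter.tendsto_id (α := ℝ)).atTop_mul_const (sub_pos.2 hc)
        filter_upwards [this.eventually_gt_atTop B] with E hE _
        simp only [id] at hE
        linarith
      · exact Filter.Eventually.of_forall fun E h1 => absurd h1 hc
  filter_upwards [(Filter.eventually_all_finset _).2 key] with E hE
  refine ⟨fun K M h1 h2 h3 => (hE (K, M) ?_).1 h1 h2, fun K M h1 h2 h3 => (hE (K, M) ?_).2⟩ <;>
  · simp only [Finset.mem_product, Finset.mem_range]; omega


/-! ### Continuation of nondegenerate zeros -/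

/-- The implicit function theorem for an analytic family of square systems whose partial
derivative at a solution is injective. -/
theorem exists_implicit_branch {V : Type*} [NormedAddCommGroup V] [NormedSpace ℝ V]
    [FiniteDimensional ℝ V] {F : ℝ × V → V} (hF : ContDiff ℝ ω F) {z : V} (hz : F (0, z) = 0)
    (hinj : ∀ h, fderiv ℝ F (0, z) (0, h) = 0 → h = 0) :
    ∃ φ : ℝ → V, φ 0 = z ∧ (∀ᶠ ε in nhds 0, ContDiffAt ℝ ω φ ε) ∧
      (∀ᶠ ε in nhds 0, F (ε, φ ε) = 0) ∧
      ∀ᶠ p in nhds ((0 : ℝ), z), F p = 0 → φ p.1 = p.2 := by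
  have : CompleteSpace V := FiniteDimensional.complete ℝ V
  have hF' : ContDiffAt ℝ ω F (0, z) := hF.contDiffAt
  have hω : (ω : WithTop ℕ∞) ≠ 0 := by simp
  have if₂ : (fderiv ℝ F (0, z) ∘L .inr ℝ ℝ V).IsInvertible := by
    have hi : Function.Injective (fderiv ℝ F (0, z) ∘L .inr ℝ ℝ V) := by
      rw [injective_iff_map_eq_zero]
      intro h hh
      exact hinj h hh
    refine ⟨(LinearEquiv.ofInjectiveEndo
      ((fderiv ℝ F (0, z) ∘L .inr ℝ ℝ V : V →L[ℝ] V) : V →ₗ[ℝ] V) hi).toContinuousLinearEquiv, ?_⟩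
    ext h
    rfl
  refine ⟨hF'.implicitFunction hω if₂, hF'.implicitFunction_apply_self hω if₂,
    (hF'.contDiffAt_implicitFunction hω if₂).eventually (by simp), ?_, ?_⟩
  · simpa [hz] using hF'.eventually_apply_implicitFunction hω if₂
  · filter_upwards [hF'.eventually_apply_eq_iff_implicitFunction hω if₂] with p hp h
    exact hp.1 (h.trans hz.symm)


/-! ### The scaled system and its regularization at ε = 0 -/

/-- The residual of the stationary equation in the scaled amplitudes `x = w / √E`, `ε = 1 / E`. -/
noncomputable def siteResidual (γ : ℕ → ℝ) (ε : ℝ) (x : ℕ → ℂ) (n : ℕ) : ℂ :=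
  x n - ((‖x n‖ ^ 2 : ℝ) : ℂ) * x n
    - (ε : ℂ) * (x (n + 1) + x (n - 1) + Complex.I * (γ n : ℂ) * x n)

/-- A regularization of the scaled system at `ε = 0`: on the sites `1, …, M` the imaginary part
of the equation is replaced by the flux identity, which does not involve `ε`. -/
noncomputable def reducedSystem (N M : ℕ) (γ : ℕ → ℝ) (ε : ℝ) (x : ℕ → ℂ) (n : ℕ) : ℂ :=
  if n = 0 then x 0 - conj (x 1)
  else if n ≤ M then
    (((conj (x (n - 1)) * x n).im - ∑ k ∈ Finset.Icc n N, γ k * ‖x k‖ ^ 2 : ℝ) : ℂ)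
      + ((‖x n‖ ^ 2 * (1 - ‖x n‖ ^ 2)
        - ε * (conj (x n) * (x (n + 1) + x (n - 1))).re : ℝ) : ℂ) * Complex.I
  else siteResidual γ ε x n

lemma ofReal_add_ofReal_mul_I_eq_zero {a b : ℝ} (h : (a : ℂ) + (b : ℂ) * Complex.I = 0) :
    a = 0 ∧ b = 0 := by
  rw [Complex.ext_iff] at h
  simpa using h

lemma conj_mul_residual_re (γ : ℕ → ℝ) (ε : ℝ) (x : ℕ → ℂ) (n : ℕ) :
    (conj (x n) * siteResidual γ ε x n).re = ‖x n‖ ^ 2 * (1 - ‖x n‖ ^ 2)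
      - ε * (conj (x n) * (x (n + 1) + x (n - 1))).re := by
  simp only [siteResidual, ← Complex.normSq_eq_norm_sq, Complex.normSq_apply]
  simp
  ring

lemma conj_mul_residual_im (γ : ℕ → ℝ) (ε : ℝ) (x : ℕ → ℂ) (n : ℕ) :
    (conj (x n) * siteResidual γ ε x n).im = ε * ((conj (x (n - 1)) * x n).im
      - (conj (x n) * x (n + 1)).im - γ n * ‖x n‖ ^ 2) := by
  simp only [siteResidual, ← Complex.normSq_eq_norm_sq, Complex.normSq_apply]
  simp
  ring

/-- The flux vanishes at the outer end because x (N + 1) = 0. The imaginary part of the residual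
carries a factor ε, which must be cancelled before telescoping. -/
lemma flux_of_residual {N L : ℕ} {γ : ℕ → ℝ} {ε : ℝ} {x : ℕ → ℂ} (hε : ε ≠ 0)
    (hx : x (N + 1) = 0) (hL : L ≤ N) (h : ∀ n, L < n → n ≤ N → siteResidual γ ε x n = 0) :
    (conj (x L) * x (L + 1)).im = ∑ n ∈ Finset.Icc (L + 1) N, γ n * ‖x n‖ ^ 2 := by
  have := flux_sum (J := fun n => (conj (x n) * x (n + 1)).im) (a := fun n => ‖x n‖ ^ 2) (γ := γ)
    hL ?_
  · simpa [hx] using this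
  · intro n h1 h2
    have e := conj_mul_residual_im γ ε x n
    rw [h n h1 h2, mul_zero, Complex.zero_im] at e
    have := (mul_eq_zero.1 e.symm).resolve_left hε
    rw [show n - 1 + 1 = n by omega]
    linarith

lemma reducedSystem_eq_zero_of_residual {N M : ℕ} {γ : ℕ → ℝ} {ε : ℝ} {x : ℕ → ℂ} (hε : ε ≠ 0)
    (hx : x (N + 1) = 0) (h0 : x 0 = conj (x 1))
    (h : ∀ n, 1 ≤ n → n ≤ N → siteResidual γ ε x n = 0) {n : ℕ} (hn : n ≤ N) :
    reducedSystem N M γ ε x n = 0 := by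
  unfold reducedSystem
  split_ifs with h1 h2
  · simp [h0]
  · have e := flux_of_residual hε hx (L := n - 1) (by omega) fun m h3 h4 => h m (by omega) h4
    rw [show n - 1 + 1 = n by omega] at e
    rw [e, ← conj_mul_residual_re γ, h n (by omega) hn]
    simp
  · exact h n (by omega) hn

/-- The flux identities at n and n + 1 subtract to the local balance, that is, to the imaginary part
of conj (x n) times the residual; the factor conj (x n) then cancels. At n = M the second identity
comes from the unmodified equations beyond M. -/
lemma residual_eq_zero_of_reducedSystem {N M : ℕ} {γ : ℕ → ℝ} {ε : ℝ} {x : ℕ → ℂ} (hε : ε ≠ 0)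
    (hMN : M ≤ N) (hx : x (N + 1) = 0) (hne : ∀ n, 1 ≤ n → n ≤ M → x n ≠ 0)
    (h : ∀ n, n ≤ N → reducedSystem N M γ ε x n = 0) {n : ℕ} (h1 : 1 ≤ n) (hn : n ≤ N) :
    siteResidual γ ε x n = 0 := by
  have htail : ∀ m, M < m → m ≤ N → siteResidual γ ε x m = 0 := by
    intro m h2 h3
    have := h m h3
    rwa [reducedSystem, if_neg (by omega), if_neg (by omega)] at this
  by_cases h2 : n ≤ M
  · have hcomp : ∀ m, 1 ≤ m → m ≤ M →
        (conj (x (m - 1)) * x m).im = ∑ k ∈ Finset.Icc m N, γ k * ‖x k‖ ^ 2 ∧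
        (conj (x m) * siteResidual γ ε x m).re = 0 := by
      intro m h3 h4
      have e := h m (by omega)
      rw [reducedSystem, if_neg (by omega), if_pos h4, ← conj_mul_residual_re γ] at e
      have e' := ofReal_add_ofReal_mul_I_eq_zero e
      exact ⟨sub_eq_zero.1 e'.1, e'.2⟩
    have hJ : (conj (x n) * x (n + 1)).im = ∑ k ∈ Finset.Icc (n + 1) N, γ k * ‖x k‖ ^ 2 := by
      rcases h2.eq_or_lt with rfl | h2
      · exact flux_of_residual hε hx hn htail
      · exact (hcomp (n + 1) (by omega) h2).1
    have him : (conj (x n) * siteResidual γ ε x n).im = 0 := by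
      rw [conj_mul_residual_im, (hcomp n h1 h2).1, hJ, ← Finset.add_sum_Ioc_eq_sum_Icc hn,
        ← Finset.Icc_add_one_left_eq_Ioc]
      ring
    have : conj (x n) * siteResidual γ ε x n = 0 := Complex.ext (hcomp n h1 h2).2 him
    exact (mul_eq_zero.1 this).resolve_left (by simpa using hne n h1 h2)
  · exact htail n (by omega) hn

/-- The stationary system in scaled amplitudes. -/
lemma isStationaryMode_smul_iff {N : ℕ} {γ : ℕ → ℝ} {E : ℝ} (hE : 0 < E) (x : ℕ → ℂ) :
    IsStationaryMode N γ E (fun n => (√E : ℂ) * x n) ↔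
      x 0 = conj (x 1) ∧ (∀ n, N < n → x n = 0) ∧
        ∀ n, 1 ≤ n → n ≤ N → siteResidual γ E⁻¹ x n = 0 := by
  have hs : ((√E : ℝ) : ℂ) ≠ 0 := by exact_mod_cast (Real.sqrt_pos.2 hE).ne'
  have hs2 : ((√E : ℝ) : ℂ) ^ 2 = E := by exact_mod_cast Real.sq_sqrt hE.le
  have hE' : (E : ℂ) ≠ 0 := by exact_mod_cast hE.ne'
  unfold IsStationaryMode
  refine and_congr ?_ (and_congr ?_ (forall_congr' fun n => forall₂_congr fun _ _ => ?_))
  · rw [map_mul, Complex.conj_ofReal, mul_right_inj' hs]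
  · simp [hE.le, Real.sqrt_eq_zero, hE.ne']
  · rw [norm_mul, mul_pow, Complex.norm_real, Real.norm_eq_abs, sq_abs, Real.sq_sqrt hE.le, siteResidual]
    push_cast
    rw [← mul_right_inj' (mul_ne_zero hs hE') (b := _ - _), mul_zero, ← sub_eq_zero (b := _ + _)]
    have : (E : ℂ) * (E : ℂ)⁻¹ = 1 := mul_inv_cancel₀ hE'
    constructor <;> intro h
    · linear_combination h - √E * (x (n + 1) + x (n - 1) + Complex.I * (γ n : ℂ) * x n) * this
    · linear_combination h + √E * (x (n + 1) + x (n - 1) + Complex.I * (γ n : ℂ) * x n) * this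

/-! ### Linearization and nondegeneracy of the limit system -/

lemma hasDerivAt_quadratic (p q r : ℝ) : HasDerivAt (fun t : ℝ => p + q * t + r * t ^ 2) q 0 := by
  have := (((hasDerivAt_id (0 : ℝ)).const_mul q).const_add p).fun_add
    (((hasDerivAt_id (0 : ℝ)).pow 2).const_mul r)
  simpa using this

lemma hasDerivAt_line (a b : ℂ) : HasDerivAt (fun t : ℝ => a + t * b) b 0 := by
  have := ((hasDerivAt_id (0 : ℝ)).ofReal_comp.mul_const b).const_add a
  simpa using this

lemma hasDerivAt_norm_sq_line (a b : ℂ) :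
    HasDerivAt (fun t : ℝ => ‖a + t * b‖ ^ 2) (2 * (conj a * b).re) 0 := by
  convert hasDerivAt_quadratic (‖a‖ ^ 2) (2 * (conj a * b).re) (‖b‖ ^ 2) using 2 with t
  simp only [← Complex.normSq_eq_norm_sq, Complex.normSq_apply]
  simp
  ring

lemma hasDerivAt_im_line (a b c d : ℂ) :
    HasDerivAt (fun t : ℝ => (conj (a + t * b) * (c + t * d)).im)
      (conj b * c + conj a * d).im 0 := by
  convert hasDerivAt_quadratic (conj a * c).im (conj b * c + conj a * d).im (conj b * d).im
    using 2 with t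
  simp
  ring

/-- The directional derivative of `reducedSystem` at `ε = 0`. -/
noncomputable def reducedLinearization (N M : ℕ) (γ : ℕ → ℝ) (z h : ℕ → ℂ) (n : ℕ) : ℂ :=
  if n = 0 then h 0 - conj (h 1)
  else if n ≤ M then
    (((conj (h (n - 1)) * z n + conj (z (n - 1)) * h n).im
        - ∑ k ∈ Finset.Icc n N, γ k * (2 * (conj (z k) * h k).re) : ℝ) : ℂ)
      + ((2 * (conj (z n) * h n).re * (1 - 2 * ‖z n‖ ^ 2) : ℝ) : ℂ) * Complex.I
  else h n - (((2 * (conj (z n) * h n).re : ℝ) : ℂ) * z n + ((‖z n‖ ^ 2 : ℝ) : ℂ) * h n)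

lemma hasDerivAt_reducedSystem (N M : ℕ) (γ : ℕ → ℝ) (z h : ℕ → ℂ) (n : ℕ) :
    HasDerivAt (fun t : ℝ => reducedSystem N M γ 0 (fun k => z k + t * h k) n)
      (reducedLinearization N M γ z h n) 0 := by
  unfold reducedSystem reducedLinearization
  split_ifs with h1 h2
  · have := (hasDerivAt_line (z 0) (h 0)).fun_sub (hasDerivAt_line (conj (z 1)) (conj (h 1)))
    simpa using this
  · have a := (hasDerivAt_im_line (z (n - 1)) (h (n - 1)) (z n) (h n)).fun_sub
      (HasDerivAt.fun_sum (u := Finset.Icc n N)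
        fun k _ => (hasDerivAt_norm_sq_line (z k) (h k)).const_mul (γ k))
    have q := hasDerivAt_norm_sq_line (z n) (h n)
    have b := q.fun_mul (q.const_sub 1)
    refine ((a.ofReal_comp.fun_add (b.ofReal_comp.mul_const Complex.I)).congr_of_eventuallyEq
      (Filter.Eventually.of_forall fun t => ?_)).congr_deriv ?_
    · simp only [zero_mul, sub_zero]
    · congr 3
      simp only [Complex.ofReal_zero, zero_mul, add_zero]
      ring
  · have q := hasDerivAt_line (z n) (h n)
    refine ((q.fun_sub ((hasDerivAt_norm_sq_line (z n) (h n)).ofReal_comp.fun_mul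
      q)).congr_of_eventuallyEq (Filter.Eventually.of_forall fun t => ?_)).congr_deriv ?_
    · simp only [siteResidual, Complex.ofReal_zero, zero_mul, sub_zero]
    · simp only [Complex.ofReal_zero, zero_mul, add_zero]

/-- The limit system is nondegenerate: its linearization is injective at a zero with amplitudes
`1` on `1, …, M` whose phase differences are not `±π/2`. -/
lemma eq_zero_of_reducedLinearization {N M : ℕ} {γ : ℕ → ℝ} {z h : ℕ → ℂ} (hM : 1 ≤ M)
    (hMN : M ≤ N) (hz0 : z 0 = conj (z 1)) (hz1 : ∀ n, 1 ≤ n → n ≤ M → ‖z n‖ = 1)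
    (hz2 : ∀ n, M < n → z n = 0)
    (hre : ∀ n, 1 ≤ n → n ≤ M → (conj (z (n - 1)) * z n).re ≠ 0)
    (hh : ∀ n, n ≤ N → reducedLinearization N M γ z h n = 0) {n : ℕ} (hn : n ≤ N) : h n = 0 := by
  have h0 : h 0 = conj (h 1) := by
    have := hh 0 (by omega)
    rwa [reducedLinearization, if_pos rfl, sub_eq_zero] at this
  have htail : ∀ m, M < m → m ≤ N → h m = 0 := by
    intro m h1 h2
    have := hh m h2
    rw [reducedLinearization, if_neg (by omega), if_neg (by omega), hz2 m h1] at this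
    simpa using this
  -- At unit amplitude 1 - 2 |z|² = -1, so the amplitude equation kills radial perturbations; only
  -- phase perturbations h = i b z remain on the block.
  have hr : ∀ m, 1 ≤ m → (conj (z m) * h m).re = 0 := by
    intro m h1
    by_cases h2 : m ≤ M
    · have := hh m (by omega)
      rw [reducedLinearization, if_neg (by omega), if_pos h2, hz1 m h1 h2] at this
      linarith [(ofReal_add_ofReal_mul_I_eq_zero this).2]
    · simp [hz2 m (by omega)]
  have hi : ∀ m, 1 ≤ m → m ≤ M →
      (conj (h (m - 1)) * z m + conj (z (m - 1)) * h m).im = 0 := by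
    intro m h1 h2
    have := hh m (by omega)
    rw [reducedLinearization, if_neg (by omega), if_pos h2, Finset.sum_eq_zero, sub_zero] at this
    · exact (ofReal_add_ofReal_mul_I_eq_zero this).1
    · intro k hk
      rw [Finset.mem_Icc] at hk
      rw [hr k (by omega)]
      simp
  have hz1' : ∀ m, m ≤ M → conj (z m) * z m = 1 := by
    intro m h2
    rw [mul_comm, Complex.mul_conj, Complex.normSq_eq_norm_sq]
    rcases Nat.eq_zero_or_pos m with rfl | h1
    · rw [hz0, Complex.norm_conj, hz1 1 le_rfl hM]; simp
    · rw [hz1 m h1 h2]; simp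
  let b : ℕ → ℝ := fun m => (conj (z m) * h m).im
  have hb : ∀ m, m ≤ M → h m = Complex.I * b m * z m := by
    intro m h2
    have hre0 : (conj (z m) * h m).re = 0 := by
      rcases Nat.eq_zero_or_pos m with rfl | h1
      · have := hr 1 le_rfl
        rw [hz0, h0, ← map_mul, Complex.conj_re, this]
      · exact hr m h1
    have : conj (z m) * h m = Complex.I * b m := by
      apply Complex.ext <;> simp [b] at hre0 ⊢
      exact hre0
    linear_combination -h m * hz1' m h2 + z m * this
  -- The linearized flux is (b m - b (m - 1)) times the nonzero real part of conj (z (m - 1)) * z m.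
  have hstep : ∀ m, 1 ≤ m → m ≤ M → b m = b (m - 1) := by
    intro m h1 h2
    have e := hi m h1 h2
    have : conj (h (m - 1)) * z m + conj (z (m - 1)) * h m
        = Complex.I * (((b m - b (m - 1) : ℝ) : ℂ) * (conj (z (m - 1)) * z m)) := by
      rw [hb m h2, hb (m - 1) (by omega)]
      simp only [map_mul, Complex.conj_I, Complex.conj_ofReal]
      push_cast
      ring
    rw [this, Complex.I_mul_im, Complex.re_ofReal_mul] at e
    exact sub_eq_zero.1 ((mul_eq_zero.1 e).resolve_right (hre m h1 h2))
  -- Conjugation at the center reverses phase perturbations, which excludes the constant one, the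
  -- infinitesimal gauge rotation.
  have hb01 : b 0 = -b 1 := by
    simp only [b]
    rw [hz0, h0, ← map_mul, Complex.conj_im]
  have hb0 : b 0 = 0 := by
    have := hstep 1 le_rfl hM
    simp only [Nat.sub_self] at this
    linarith
  have hball : ∀ m, m ≤ M → b m = 0 := by
    intro m
    induction m with
    | zero => exact fun _ => hb0
    | succ k ih =>
      intro h2
      rw [hstep (k + 1) (by omega) h2]
      exact ih (by omega)
  by_cases h2 : n ≤ M
  · rw [hb n h2, hball n h2]; simp
  · exact htail n (by omega) hn

/-! ### Finite-dimensional formulation -/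

/-- A vector on the sites `0, …, N`, extended by zero. -/
noncomputable def extendByZero (N : ℕ) (v : Fin (N + 1) → ℂ) (n : ℕ) : ℂ :=
  if h : n < N + 1 then v ⟨n, h⟩ else 0

lemma extendByZero_of_lt {N n : ℕ} (v : Fin (N + 1) → ℂ) (h : N < n) : extendByZero N v n = 0 := by
  simp [extendByZero, show ¬ n < N + 1 by omega]

lemma extendByZero_restrict {N : ℕ} {x : ℕ → ℂ} (hx : ∀ n, N < n → x n = 0) :
    extendByZero N (fun i => x i) = x := by
  funext n
  by_cases h : n < N + 1
  · simp [extendByZero, h]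
  · rw [extendByZero_of_lt _ (by omega), hx n (by omega)]

lemma contDiff_extendByZero (N n : ℕ) : ContDiff ℝ ω (fun v => extendByZero N v n) := by
  unfold extendByZero
  split_ifs
  · fun_prop
  · fun_prop

lemma contDiff_conj : ContDiff ℝ ω (fun z : ℂ => conj z) := Complex.conjCLE.contDiff

/-- `reducedSystem` as a family of square systems. -/
noncomputable def reducedMap (N M : ℕ) (γ : ℕ → ℝ) (p : ℝ × (Fin (N + 1) → ℂ)) :
    Fin (N + 1) → ℂ :=
  fun i => reducedSystem N M γ p.1 (extendByZero N p.2) i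

lemma contDiff_reducedMap (N M : ℕ) (γ : ℕ → ℝ) : ContDiff ℝ ω (reducedMap N M γ) := by
  rw [contDiff_pi]
  intro i
  have hx : ∀ n, ContDiff ℝ ω
      (fun p : ℝ × (Fin (N + 1) → ℂ) => extendByZero N p.2 n) := fun n =>
    (contDiff_extendByZero N n).comp contDiff_snd
  have hc : ∀ {f : ℝ × (Fin (N + 1) → ℂ) → ℂ}, ContDiff ℝ ω f →
      ContDiff ℝ ω (fun p => conj (f p)) := fun hf => contDiff_conj.comp hf
  have hR : ∀ {f : ℝ × (Fin (N + 1) → ℂ) → ℝ}, ContDiff ℝ ω f →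
      ContDiff ℝ ω (fun p => (f p : ℂ)) := fun hf => Complex.ofRealCLM.contDiff.comp hf
  have hre : ∀ {f : ℝ × (Fin (N + 1) → ℂ) → ℂ}, ContDiff ℝ ω f →
      ContDiff ℝ ω (fun p => (f p).re) := fun hf => Complex.reCLM.contDiff.comp hf
  have him : ∀ {f : ℝ × (Fin (N + 1) → ℂ) → ℂ}, ContDiff ℝ ω f →
      ContDiff ℝ ω (fun p => (f p).im) := fun hf => Complex.imCLM.contDiff.comp hf
  have hn : ∀ n, ContDiff ℝ ω
      (fun p : ℝ × (Fin (N + 1) → ℂ) => ‖extendByZero N p.2 n‖ ^ 2) := fun n =>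
    (hx n).norm_sq ℝ
  unfold reducedMap reducedSystem siteResidual
  split_ifs with h1 h2
  · exact (hx 0).sub (hc (hx 1))
  · refine (hR ((him ((hc (hx _)).mul (hx _))).sub
      (ContDiff.sum fun k _ => contDiff_const.mul (hn k)))).add
      ((hR (((hn _).mul (contDiff_const.sub (hn _))).sub (contDiff_fst.mul
        (hre ((hc (hx _)).mul ((hx _).add (hx _))))))).mul contDiff_const)
  · exact ((hx _).sub ((hR (hn _)).mul (hx _))).sub ((hR contDiff_fst).mul
      (((hx _).add (hx _)).add (contDiff_const.mul (hx _))))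

/-- Both sides are the derivative at t = 0 along the line z + t h; smoothness of the map identifies
this with the Fréchet derivative. -/
lemma fderiv_reducedMap (N M : ℕ) (γ : ℕ → ℝ) (z h : Fin (N + 1) → ℂ) (i : Fin (N + 1)) :
    fderiv ℝ (reducedMap N M γ) (0, z) (0, h) i =
      reducedLinearization N M γ (extendByZero N z) (extendByZero N h) i := by
  have hF : HasFDerivAt (reducedMap N M γ) (fderiv ℝ (reducedMap N M γ) (0, z)) (0, z) :=
    ((contDiff_reducedMap N M γ).differentiable (by simp) _).hasFDerivAt
  have hline : HasDerivAt (fun t : ℝ => ((0 : ℝ), z + t • h)) ((0 : ℝ), h) 0 := by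
    refine (hasDerivAt_const _ _).prodMk ?_
    simpa using ((hasDerivAt_id (0 : ℝ)).smul_const h).const_add z
  have hcomp := HasFDerivAt.comp_hasDerivAt_of_eq (0 : ℝ) hF hline (by simp)
  have := hasDerivAt_pi.1 hcomp i
  refine this.unique ((hasDerivAt_reducedSystem N M γ (extendByZero N z)
    (extendByZero N h) i).congr_of_eventuallyEq (Filter.Eventually.of_forall fun t => ?_))
  simp only [reducedMap, Function.comp]
  congr 1
  funext k
  unfold extendByZero
  split_ifs <;> simp


/-! ### Limit modes and their number -/

/-- A solution of the limit system: amplitudes `1` on the sites `1, …, M` and `0` beyond, with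
phase differences determined by the flux identity. -/
structure IsLimitMode (M : ℕ) (γ : ℕ → ℝ) (z : ℕ → ℂ) : Prop where
  center : z 0 = conj (z 1)
  norm_eq : ∀ n, 1 ≤ n → n ≤ M → ‖z n‖ = 1
  tail : ∀ n, M < n → z n = 0
  flux : ∀ n, 1 ≤ n → n ≤ M → (conj (z (n - 1)) * z n).im = ∑ k ∈ Finset.Icc n M, γ k

/-- The factors fix successive ratios, leaving an initial phase c; the center condition asks that c²
= conj (q 1), solvable in ℂ. -/
lemma exists_of_phase_factors (M : ℕ) {q : ℕ → ℂ} (hq : ∀ n, ‖q n‖ = 1) (hM : 1 ≤ M) :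
    ∃ z : ℕ → ℂ, z 0 = conj (z 1) ∧ (∀ n, n ≤ M → ‖z n‖ = 1) ∧ (∀ n, M < n → z n = 0) ∧
      ∀ n, 1 ≤ n → n ≤ M → conj (z (n - 1)) * z n = q n := by
  obtain ⟨c, hc⟩ := IsAlgClosed.exists_pow_nat_eq (conj (q 1)) (n := 2) (by norm_num)
  have hcn : ‖c‖ = 1 := by
    have := congrArg norm hc
    rw [norm_pow, Complex.norm_conj, hq] at this
    exact (pow_eq_one_iff_of_nonneg (norm_nonneg _) (by norm_num)).1 this
  have hunit : ∀ a : ℂ, ‖a‖ = 1 → conj a * a = 1 := fun a ha => by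
    rw [mul_comm, Complex.mul_conj, Complex.normSq_eq_norm_sq, ha]; simp
  let y : ℕ → ℂ := fun n => c * ∏ k ∈ Finset.Icc 1 n, q k
  have hy : ∀ n, ‖y n‖ = 1 := fun n => by simp [y, hcn, hq]
  have hys : ∀ n, 1 ≤ n → y n = y (n - 1) * q n := by
    intro n hn
    obtain ⟨m, rfl⟩ : ∃ m, n = m + 1 := ⟨n - 1, by omega⟩
    simp only [y, Nat.add_sub_cancel]
    rw [Finset.prod_Icc_succ_top (by omega), mul_assoc]
  refine ⟨fun n => if n ≤ M then y n else 0, ?_, ?_, ?_, ?_⟩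
  · have h1 := hunit _ (hq 1)
    have h2 := hunit _ hcn
    simp only [hM, if_true, Nat.zero_le, y]
    simp only [Finset.Icc_self, Finset.prod_singleton, map_mul]
    simp only [show Finset.Icc 1 0 = (∅ : Finset ℕ) by rfl, Finset.prod_empty, mul_one]
    linear_combination -c * h2 + conj c * hc
  · intro n hn
    simp [hn, hy]
  · intro n hn
    simp [show ¬ n ≤ M by omega]
  · intro n h1 h2
    simp only [h2, show n - 1 ≤ M by omega, if_true]
    rw [hys n h1, ← mul_assoc, hunit _ (hy _), one_mul]

/-- By the center condition the first factor is (z 1)², which fixes z 1 up to sign; the other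
factors propagate that sign outwards. -/
lemma eq_or_eq_neg_of_phase_factors {M : ℕ} {z z' : ℕ → ℂ} (hM : 1 ≤ M)
    (h0 : z 0 = conj (z 1)) (h0' : z' 0 = conj (z' 1)) (ht : ∀ n, M < n → z n = 0)
    (ht' : ∀ n, M < n → z' n = 0) (hne : ∀ n, 1 ≤ n → n ≤ M → z n ≠ 0)
    (h : ∀ n, 1 ≤ n → n ≤ M → conj (z (n - 1)) * z n = conj (z' (n - 1)) * z' n) :
    z' = z ∨ z' = fun n => -z n := by
  have aux : ∀ c : ℂ, conj c * c = 1 → z' 1 = c * z 1 → z' 0 = c * z 0 →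
      ∀ n, n ≤ M → z' n = c * z n := by
    intro c hc hc1 hc0 n
    induction n with
    | zero => exact fun _ => hc0
    | succ k ih =>
      intro hk
      have e := h (k + 1) (by omega) hk
      rw [Nat.add_sub_cancel, ih (by omega), map_mul] at e
      have hk0 : conj (z k) ≠ 0 := by
        rcases Nat.eq_zero_or_pos k with rfl | hk0
        · rw [h0]; simpa using hne 1 le_rfl hM
        · simpa using hne k hk0 (by omega)
      apply mul_left_cancel₀ hk0
      linear_combination -c * e - conj (z k) * z' (k + 1) * hc
  have h1 := h 1 le_rfl hM
  simp only [Nat.sub_self, h0, h0', Complex.conj_conj] at h1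
  have ext' : ∀ c : ℂ, (∀ n, n ≤ M → z' n = c * z n) → z' = fun n => c * z n := by
    intro c hc
    funext n
    by_cases hn : n ≤ M
    · exact hc n hn
    · rw [ht n (by omega), ht' n (by omega), mul_zero]
  rcases mul_self_eq_mul_self_iff.1 h1.symm with e | e
  · left
    simpa using ext' 1 (aux 1 (by simp) (by simp [e]) (by simp [h0, h0', e]))
  · right
    simpa using ext' (-1) (aux (-1) (by simp) (by simp [e]) (by simp [h0, h0', e]))

namespace IsLimitMode

variable {M : ℕ} {γ : ℕ → ℝ} {z : ℕ → ℂ}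

lemma re_sq (h : IsLimitMode M γ z) (hM : 1 ≤ M) {n : ℕ} (h1 : 1 ≤ n) (h2 : n ≤ M) :
    (conj (z (n - 1)) * z n).re ^ 2 = 1 - (∑ k ∈ Finset.Icc n M, γ k) ^ 2 := by
  have hn : ‖conj (z (n - 1)) * z n‖ = 1 := by
    rw [norm_mul, Complex.norm_conj, h.norm_eq n h1 h2, mul_one]
    rcases Nat.eq_zero_or_pos (n - 1) with e | e
    · rw [e, h.center, Complex.norm_conj, h.norm_eq 1 le_rfl hM]
    · exact h.norm_eq _ e (by omega)
  have := Complex.normSq_eq_norm_sq (conj (z (n - 1)) * z n)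
  rw [hn, Complex.normSq_apply, h.flux n h1 h2] at this
  linarith

lemma re_ne_zero (h : IsLimitMode M γ z) (hM : 1 ≤ M) (hγ : PhaseCondition γ M) {n : ℕ}
    (h1 : 1 ≤ n) (h2 : n ≤ M) : (conj (z (n - 1)) * z n).re ≠ 0 := by
  intro e
  have := h.re_sq hM h1 h2
  rw [e] at this
  have := (sq_lt_one_iff_abs_lt_one _).2 (hγ n h1 h2)
  linarith

end IsLimitMode

/-- Up to sign there are exactly `2^M` limit modes. -/
theorem exists_limitModes {M : ℕ} {γ : ℕ → ℝ} (hM : 1 ≤ M) (hγ : PhaseCondition γ M) :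
    ∃ Z : Fin (2 ^ M) → ℕ → ℂ, (∀ j, IsLimitMode M γ (Z j)) ∧
      (∀ j k, j ≠ k → Z j ≠ Z k ∧ Z j ≠ fun n => -Z k n) ∧
      ∀ z, IsLimitMode M γ z → ∃ j, z = Z j ∨ z = fun n => -Z j n := by
  let s : ℕ → ℝ := fun n => ∑ k ∈ Finset.Icc n M, γ k
  have hs : ∀ n, 1 ≤ n → n ≤ M → 0 < 1 - s n ^ 2 := fun n h1 h2 =>
    sub_pos.2 ((sq_lt_one_iff_abs_lt_one _).2 (hγ n h1 h2))
  -- The sign at site n is stored at index n - 1. Outside 1, …, M the factor `q` below is set to 1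
  -- so as to be unimodular everywhere.
  let r : (Fin M → Bool) → ℕ → ℝ := fun σ n =>
    if h : n - 1 < M then (if σ ⟨n - 1, h⟩ then √(1 - s n ^ 2) else -√(1 - s n ^ 2)) else 0
  let q : (Fin M → Bool) → ℕ → ℂ := fun σ n =>
    if 1 ≤ n ∧ n ≤ M then ⟨r σ n, s n⟩ else 1
  have hr : ∀ σ n, 1 ≤ n → n ≤ M → r σ n ^ 2 = 1 - s n ^ 2 := by
    intro σ n h1 h2
    have := Real.sq_sqrt (hs n h1 h2).le
    simp only [r, show n - 1 < M by omega, dif_pos]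
    split_ifs
    · exact this
    · rw [neg_sq, this]
  have hq : ∀ σ n, ‖q σ n‖ = 1 := by
    intro σ n
    by_cases hn : 1 ≤ n ∧ n ≤ M
    · simp only [q, hn, and_self, if_true]
      rw [← pow_eq_one_iff_of_nonneg (norm_nonneg _) two_ne_zero, ← Complex.normSq_eq_norm_sq,
        Complex.normSq_mk]
      linarith [hr σ n hn.1 hn.2]
    · simp [q, hn]
  choose Z hZ0 hZ1 hZ2 hZ3 using fun σ => exists_of_phase_factors M (hq σ) hM
  have hre : ∀ σ n, 1 ≤ n → n ≤ M → (conj (Z σ (n - 1)) * Z σ n).re = r σ n := by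
    intro σ n h1 h2
    rw [hZ3 σ n h1 h2]
    simp [q, h1, h2]
  have him : ∀ σ n, 1 ≤ n → n ≤ M → (conj (Z σ (n - 1)) * Z σ n).im = s n := by
    intro σ n h1 h2
    rw [hZ3 σ n h1 h2]
    simp [q, h1, h2]
  have hZ : ∀ σ, IsLimitMode M γ (Z σ) := fun σ =>
    ⟨hZ0 σ, fun n _ h => hZ1 σ n h, hZ2 σ, him σ⟩
  have hinj : ∀ σ τ, (∀ n, 1 ≤ n → n ≤ M →
      (conj (Z σ (n - 1)) * Z σ n).re = (conj (Z τ (n - 1)) * Z τ n).re) → σ = τ := by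
    intro σ τ h
    funext i
    have e := h (i + 1) (by omega) (by omega)
    rw [hre _ _ (by omega) (by omega), hre _ _ (by omega) (by omega)] at e
    have hp := Real.sqrt_pos.2 (hs (i + 1) (by omega) (by omega))
    simp only [r, Nat.add_sub_cancel, i.2, dif_pos, Fin.eta] at e
    cases hσ : σ i <;> cases hτ : τ i <;> simp only [hσ, hτ] at e ⊢ <;> simp at e <;> linarith
  have hcard : Fintype.card (Fin M → Bool) = 2 ^ M := by simp
  let e : Fin (2 ^ M) ≃ (Fin M → Bool) := (Fintype.equivFinOfCardEq hcard).symm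
  refine ⟨fun j => Z (e j), fun j => hZ _, fun j k hjk => ⟨fun h => ?_, fun h => ?_⟩,
    fun z hz => ?_⟩
  · exact hjk (e.injective (hinj _ _ fun n _ _ => by simp only [h]))
  · exact hjk (e.injective (hinj _ _ fun n _ _ => by simp only [h]; simp))
  · let σ : Fin M → Bool := fun i => decide (0 < (conj (z i) * z (i + 1)).re)
    refine ⟨e.symm σ, ?_⟩
    simp only [Equiv.apply_symm_apply]
    refine eq_or_eq_neg_of_phase_factors hM (hZ0 σ) hz.center (hZ2 σ) hz.tail ?_ ?_
    · intro n h1 h2 h0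
      have := hZ1 σ n h2
      simp [h0] at this
    · intro n h1 h2
      apply Complex.ext
      · rw [hre σ n h1 h2]
        have e1 := hz.re_sq hM h1 h2
        have e2 := Real.sqrt_sq_eq_abs (conj (z (n - 1)) * z n).re
        rw [e1] at e2
        simp only [r, σ, show n - 1 < M by omega, dif_pos, show n - 1 + 1 = n by omega,
          decide_eq_true_eq]
        change √(1 - s n ^ 2) = _ at e2
        rw [e2]
        split_ifs with hc
        · exact abs_of_pos hc
        · rw [abs_of_nonpos (not_lt.1 hc), neg_neg]
      · rw [him σ n h1 h2, hz.flux n h1 h2]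


/-! ### Branches through the limit modes and their completeness -/

lemma sum_mul_norm_sq_eq {N M n : ℕ} {γ : ℕ → ℝ} {z : ℕ → ℂ} (hMN : M ≤ N) (hn : 1 ≤ n)
    (h1 : ∀ k, 1 ≤ k → k ≤ M → ‖z k‖ = 1) (h2 : ∀ k, M < k → z k = 0) :
    ∑ k ∈ Finset.Icc n N, γ k * ‖z k‖ ^ 2 = ∑ k ∈ Finset.Icc n M, γ k := by
  rw [← Finset.sum_subset (Finset.Icc_subset_Icc_right hMN)]
  · refine Finset.sum_congr rfl fun k hk => ?_
    rw [Finset.mem_Icc] at hk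
    rw [h1 k (by omega) hk.2]; simp
  · intro k hk hk'
    rw [Finset.mem_Icc] at hk hk'
    rw [h2 k (by omega)]; simp

lemma IsLimitMode.reducedSystem_eq_zero {N M : ℕ} {γ : ℕ → ℝ} {z : ℕ → ℂ}
    (h : IsLimitMode M γ z) (hMN : M ≤ N) (n : ℕ) : reducedSystem N M γ 0 z n = 0 := by
  unfold reducedSystem
  split_ifs with h1 h2
  · simp [h.center]
  · rw [sum_mul_norm_sq_eq hMN (by omega) h.norm_eq h.tail, h.flux n (by omega) h2,
      h.norm_eq n (by omega) h2]
    simp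
  · simp [siteResidual, h.tail n (by omega)]

lemma isLimitMode_of_reducedSystem {N M : ℕ} {γ : ℕ → ℝ} {x : ℕ → ℂ} (hMN : M ≤ N)
    (h : ∀ n, n ≤ N → reducedSystem N M γ 0 x n = 0)
    (h1 : ∀ n, 1 ≤ n → n ≤ M → ‖x n‖ = 1) (h2 : ∀ n, M < n → x n = 0) : IsLimitMode M γ x := by
  refine ⟨?_, h1, h2, fun n h3 h4 => ?_⟩
  · have := h 0 (by omega)
    rwa [reducedSystem, if_pos rfl, sub_eq_zero] at this
  · have := h n (by omega)
    rw [reducedSystem, if_neg (by omega), if_pos h4, sum_mul_norm_sq_eq hMN h3 h1 h2] at this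
    exact sub_eq_zero.1 (ofReal_add_ofReal_mul_I_eq_zero this).1

/-- The sign is what the center condition leaves of the gauge group, so one branch accounts for a
pair of zeros ±v. -/
lemma reducedSystem_neg {N M : ℕ} {γ : ℕ → ℝ} {ε : ℝ} {x : ℕ → ℂ} {n : ℕ}
    (h : reducedSystem N M γ ε x n = 0) : reducedSystem N M γ ε (fun k => -x k) n = 0 := by
  unfold reducedSystem at h ⊢
  split_ifs at h ⊢ with h1 h2
  · rw [map_neg]
    linear_combination -h
  · simp only [map_neg, neg_mul_neg, norm_neg]
    rw [← h]
    congr 4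
    congr 1
    congr 1
    ring
  · unfold siteResidual at h ⊢
    rw [norm_neg]
    linear_combination -h

/-- The boundary condition at the center fixes the gauge up to sign. -/
lemma eq_or_eq_neg_of_gaugeEquiv {N : ℕ} {γ : ℕ → ℝ} {E : ℝ} {v w : ℕ → ℂ} (hN : 1 ≤ N)
    (hv : IsStationaryMode N γ E v) (hw : IsStationaryMode N γ E w) (h : GaugeEquiv N v w)
    (h1 : w 1 ≠ 0) : v = w ∨ v = fun n => -w n := by
  obtain ⟨c, hc, hvw⟩ := h
  have h2 : v 2 = c * w 2 := by
    by_cases hN2 : 2 ≤ N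
    · exact hvw 2 (by omega) hN2
    · rw [hv.2.1 2 (by omega), hw.2.1 2 (by omega), mul_zero]
  have e1 := hvw 1 le_rfl hN
  have ev := hv.2.2 1 le_rfl hN
  have ew := hw.2.2 1 le_rfl hN
  simp only [Nat.reduceAdd, Nat.sub_self] at ev ew
  rw [h2, e1, norm_mul, hc, one_mul, hv.1, e1, map_mul] at ev
  rw [hw.1] at ew
  have h1' : conj (w 1) ≠ 0 := by simpa using h1
  -- In the equation at site 1 every term is multiplied by c except w_0 = conj w_1, which is
  -- multiplied by conj c.
  have hcc : conj c = c := by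
    apply mul_right_cancel₀ h1'
    linear_combination c * ew - ev
  have hsq : c * c = 1 * 1 := by
    have : conj c * c = 1 := by
      rw [mul_comm, Complex.mul_conj, Complex.normSq_eq_norm_sq, hc]; simp
    rwa [hcc, ← mul_one (1 : ℂ)] at this
  have hall : ∀ n, v n = c * w n := by
    intro n
    rcases Nat.eq_zero_or_pos n with rfl | hn
    · rw [hv.1, hw.1, e1, map_mul, hcc]
    · by_cases hn' : n ≤ N
      · exact hvw n hn hn'
      · rw [hv.2.1 n (by omega), hw.2.1 n (by omega), mul_zero]
  rcases mul_self_eq_mul_self_iff.1 hsq with rfl | rfl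
  · left; funext n; simp [hall n]
  · right; funext n; simp [hall n]

lemma extendByZero_apply {N : ℕ} (v : Fin (N + 1) → ℂ) (i : Fin (N + 1)) :
    extendByZero N v i = v i := by
  simp [extendByZero, i.2]

lemma extendByZero_neg {N : ℕ} (v : Fin (N + 1) → ℂ) :
    extendByZero N (-v) = fun n => -extendByZero N v n := by
  funext n
  unfold extendByZero
  split_ifs <;> simp

lemma extendByZero_injective (N : ℕ) : Function.Injective (extendByZero N) := by
  intro v w h
  funext i
  rw [← extendByZero_apply v, h, extendByZero_apply]

lemma reducedMap_eq_zero_iff {N M : ℕ} {γ : ℕ → ℝ} {ε : ℝ} {v : Fin (N + 1) → ℂ} :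
    reducedMap N M γ (ε, v) = 0 ↔
      ∀ n, n ≤ N → reducedSystem N M γ ε (extendByZero N v) n = 0 := by
  constructor
  · intro h n hn
    exact congrFun h ⟨n, by omega⟩
  · intro h
    funext i
    exact h i (by omega)

/-- Through each limit mode passes a locally unique analytic branch of zeros of `reducedMap`. -/
theorem IsLimitMode.exists_branch {N M : ℕ} {γ : ℕ → ℝ} {z : ℕ → ℂ} (h : IsLimitMode M γ z)
    (hM : 1 ≤ M) (hMN : M ≤ N) (hγ : PhaseCondition γ M) :
    ∃ φ : ℝ → Fin (N + 1) → ℂ, extendByZero N (φ 0) = z ∧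
      (∀ᶠ ε in nhds 0, ContDiffAt ℝ ω φ ε) ∧
      (∀ᶠ ε in nhds 0, reducedMap N M γ (ε, φ ε) = 0) ∧
      ∀ᶠ p in nhds ((0 : ℝ), φ 0), reducedMap N M γ p = 0 → φ p.1 = p.2 := by
  have hz : extendByZero N (fun i => z i) = z :=
    extendByZero_restrict fun n hn => h.tail n (by omega)
  have hinj : ∀ v, fderiv ℝ (reducedMap N M γ) (0, fun i => z i) (0, v) = 0 → v = 0 := by
    intro v hv
    funext i
    rw [← extendByZero_apply v i]
    refine eq_zero_of_reducedLinearization (N := N) (γ := γ) hM hMN h.center h.norm_eq h.tail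
      (fun n h1 h2 => h.re_ne_zero hM hγ h1 h2) (fun n hn => ?_) (by omega)
    have := congrFun hv ⟨n, by omega⟩
    rwa [fderiv_reducedMap, hz] at this
  obtain ⟨φ, h0, h1, h2, h3⟩ := exists_implicit_branch (contDiff_reducedMap N M γ)
    (reducedMap_eq_zero_iff.2 fun n _ => by rw [hz]; exact h.reducedSystem_eq_zero hMN n) hinj
  exact ⟨φ, by rw [h0, hz], h1, h2, by rwa [h0]⟩

/-- By compactness, for small `ε ≥ 0` all zeros of `reducedMap` with large sites `1, …, M` lie on
the branches through the limit modes, up to sign. -/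
theorem eventually_mem_branch {N M : ℕ} {γ : ℕ → ℝ} (hMN : M ≤ N)
    {ι : Type*} {Z : ι → ℕ → ℂ}
    (hZ : ∀ z, IsLimitMode M γ z → ∃ j, z = Z j ∨ z = fun n => -Z j n)
    {φ : ι → ℝ → Fin (N + 1) → ℂ} (hφ0 : ∀ j, extendByZero N (φ j 0) = Z j)
    (hφ : ∀ j, ∀ᶠ p in nhds ((0 : ℝ), φ j 0), reducedMap N M γ p = 0 → φ j p.1 = p.2)
    (C R : ℝ) :
    ∀ᶠ ε in nhds (0 : ℝ), ∀ v ∈ Metric.closedBall (0 : Fin (N + 1) → ℂ) R,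
      reducedMap N M γ (ε, v) = 0 →
      (∀ n, 1 ≤ n → n ≤ M → |‖extendByZero N v n‖ ^ 2 - 1| ≤ C * ε) →
      (∀ n, M < n → ‖extendByZero N v n‖ ^ 2 ≤ C * ε ^ 2) →
      ∃ j, v = φ j ε ∨ v = -φ j ε := by
  apply (isCompact_closedBall _ _).eventually_forall_of_forall_eventually
  intro v _
  have hx : ∀ n, Continuous (fun p : ℝ × (Fin (N + 1) → ℂ) => extendByZero N p.2 n) := fun n =>
    (contDiff_extendByZero N n).continuous.comp continuous_snd
  let S : Set (ℝ × (Fin (N + 1) → ℂ)) := {p | reducedMap N M γ p = 0 ∧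
    (∀ n, 1 ≤ n → n ≤ M → |‖extendByZero N p.2 n‖ ^ 2 - 1| ≤ C * p.1) ∧
    (∀ n, M < n → ‖extendByZero N p.2 n‖ ^ 2 ≤ C * p.1 ^ 2)}
  have hS : IsClosed S := by
    have h1 : IsClosed {p : ℝ × (Fin (N + 1) → ℂ) | ∀ n, 1 ≤ n → n ≤ M →
        |‖extendByZero N p.2 n‖ ^ 2 - 1| ≤ C * p.1} := by
      simp only [Set.ofPred_forall]
      refine isClosed_iInter fun n => isClosed_iInter fun _ => isClosed_iInter fun _ =>
        isClosed_le ?_ ?_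
      · exact (((hx n).norm.pow 2).sub continuous_const).abs
      · fun_prop
    have h2 : IsClosed {p : ℝ × (Fin (N + 1) → ℂ) | ∀ n, M < n →
        ‖extendByZero N p.2 n‖ ^ 2 ≤ C * p.1 ^ 2} := by
      simp only [Set.ofPred_forall]
      refine isClosed_iInter fun n => isClosed_iInter fun _ => isClosed_le ?_ ?_
      · exact (hx n).norm.pow 2
      · fun_prop
    exact (isClosed_eq (contDiff_reducedMap N M γ).continuous continuous_const).inter
      (h1.inter h2)
  by_cases hv : ((0 : ℝ), v) ∈ S
  -- At ε = 0 the bounds C ε and C ε² collapse, so the amplitudes are exactly 1 and 0.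
  · have hlim : IsLimitMode M γ (extendByZero N v) := by
      obtain ⟨e1, e2, e3⟩ := hv
      refine isLimitMode_of_reducedSystem hMN (reducedMap_eq_zero_iff.1 e1) (fun n h1 h2 => ?_)
        fun n h1 => ?_
      · have := e2 n h1 h2
        rw [mul_zero, abs_nonpos_iff, sub_eq_zero] at this
        exact (pow_eq_one_iff_of_nonneg (norm_nonneg _) two_ne_zero).1 this
      · have := e3 n h1
        simp only at this
        have : ‖extendByZero N v n‖ ^ 2 = 0 := le_antisymm (by simpa using this) (by positivity)
        simpa using this
    obtain ⟨j, hj⟩ := hZ _ hlim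
    rcases hj with hj | hj
    · have : v = φ j 0 := extendByZero_injective N (by rw [hj, hφ0])
      subst this
      filter_upwards [hφ j] with p hp h1 _ _
      exact ⟨j, Or.inl (hp h1).symm⟩
    · have : -v = φ j 0 := extendByZero_injective N (by rw [extendByZero_neg, hφ0, hj]; simp)
      have hcont : Filter.Tendsto (fun p : ℝ × (Fin (N + 1) → ℂ) => (p.1, -p.2))
          (nhds ((0 : ℝ), v)) (nhds ((0 : ℝ), φ j 0)) := by
        rw [← this]
        exact Continuous.tendsto (by fun_prop) ((0 : ℝ), v)
      filter_upwards [hcont.eventually (hφ j)] with p hp h1 _ _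
      refine ⟨j, Or.inr ?_⟩
      rw [hp, neg_neg]
      rw [reducedMap_eq_zero_iff] at h1 ⊢
      intro n hn
      rw [extendByZero_neg]
      exact reducedSystem_neg (h1 n hn)
  -- As S is closed, a whole neighbourhood of (0, v) contains no zero obeying the bounds.
  · filter_upwards [hS.isOpen_compl.mem_nhds hv] with p hp h1 h2 h3
    exact absurd ⟨h1, h2, h3⟩ hp

/-! ### Return to the unscaled amplitudes -/

lemma norm_sq_sqrt_mul {E : ℝ} (hE : 0 ≤ E) (a : ℂ) :
    ‖((√E : ℝ) : ℂ) * a‖ ^ 2 = E * ‖a‖ ^ 2 := by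
  rw [norm_mul, mul_pow, Complex.norm_real, Real.norm_eq_abs, sq_abs, Real.sq_sqrt hE]

/-- A small zero of `reducedMap` near a limit mode is, after rescaling, a stationary mode with
large sites `1, …, M`. -/
lemma stationary_of_reducedMap {N M : ℕ} {γ : ℕ → ℝ} (hMN : M ≤ N) {E : ℝ}
    (hE : 100 ≤ E) {v : Fin (N + 1) → ℂ} (hv : reducedMap N M γ (E⁻¹, v) = 0)
    (h1 : ∀ n, 1 ≤ n → n ≤ M → 1 / 2 < ‖extendByZero N v n‖ ^ 2)
    (h2 : ∀ n, M < n → ‖extendByZero N v n‖ ^ 2 < 1 / 2) :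
    IsStationaryMode N γ E (fun n => ((√E : ℝ) : ℂ) * extendByZero N v n) ∧
      HasProfile N M 32 E (fun n => ((√E : ℝ) : ℂ) * extendByZero N v n) := by
  have hE0 : 0 < E := by linarith
  rw [reducedMap_eq_zero_iff] at hv
  have hst : IsStationaryMode N γ E (fun n => ((√E : ℝ) : ℂ) * extendByZero N v n) := by
    rw [isStationaryMode_smul_iff hE0]
    refine ⟨?_, fun n hn => extendByZero_of_lt v hn, fun n h3 h4 =>
      residual_eq_zero_of_reducedSystem (inv_ne_zero hE0.ne') hMN
        (extendByZero_of_lt v (by omega)) (fun m h5 h6 h7 => ?_) hv h3 h4⟩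
    · have := hv 0 (by omega)
      rwa [reducedSystem, if_pos rfl, sub_eq_zero] at this
    · have := h1 m h5 h6
      rw [h7] at this
      norm_num at this
  refine ⟨hst, fun n h3 h4 => ?_, fun n h3 h4 => ?_⟩
  -- The threshold 1/2 only selects the alternative; the sharp bounds come from the dichotomy for
  -- exact solutions.
  · rcases hst.large_or_small (by linarith) h3 (by omega) with h | h
    · exact h.trans (by norm_num)
    · exfalso
      rw [norm_sq_sqrt_mul hE0.le, le_div_iff₀ hE0] at h
      nlinarith [h1 n h3 h4, mul_pos hE0 hE0]
  · rcases hst.large_or_small (by linarith) (by omega : 1 ≤ n) h4 with h | h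
    · exfalso
      rw [norm_sq_sqrt_mul hE0.le] at h
      nlinarith [h2 n h3, (abs_le.1 h).1]
    · exact h

/-- The branches with large sites `1, …, M` and their completeness, for all large `E`. -/
theorem exists_branchSystem {N M : ℕ} {γ : ℕ → ℝ} (hM : 1 ≤ M) (hMN : M ≤ N)
    (hγ : PhaseCondition γ M) :
    ∃ u : Fin (2 ^ M) → ℝ → ℕ → ℂ, ∀ᶠ E₀ in Filter.atTop,
      IsBranchSystem N γ M E₀ 32 u ∧ ∀ E, E₀ < E → ∀ w, IsStationaryMode N γ E w →
        HasProfile N M 32 E w → ∃ j, GaugeEquiv N w (u j E) := by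
  obtain ⟨Z, hZ, hdist, hcomp⟩ := exists_limitModes hM hγ
  choose φ hφ0 hφsmooth hφzero hφuniq using fun j => (hZ j).exists_branch hM hMN hγ
  have hcont : ∀ j, ContinuousAt (φ j) 0 := fun j => (hφsmooth j).self_of_nhds.continuousAt
  have hcoord : ∀ j n, ContinuousAt (fun ε => ‖extendByZero N (φ j ε) n‖ ^ 2) 0 := fun j n =>
    (((contDiff_extendByZero N n).continuous.continuousAt.comp (hcont j)).norm.pow 2)
  have hlarge : ∀ᶠ ε in nhds 0, ∀ j, ∀ n ∈ Finset.Icc 1 M,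
      1 / 2 < ‖extendByZero N (φ j ε) n‖ ^ 2 := by
    rw [Filter.eventually_all]
    intro j
    rw [Filter.eventually_all_finset]
    intro n hn
    rw [Finset.mem_Icc] at hn
    refine (hcoord j n).eventually_const_lt ?_
    beta_reduce
    rw [hφ0, (hZ j).norm_eq n hn.1 hn.2]
    norm_num
  have hsmall : ∀ᶠ ε in nhds 0, ∀ j, ∀ n ∈ Finset.Ioc M N,
      ‖extendByZero N (φ j ε) n‖ ^ 2 < 1 / 2 := by
    rw [Filter.eventually_all]
    intro j
    rw [Filter.eventually_all_finset]
    intro n hn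
    rw [Finset.mem_Ioc] at hn
    refine (hcoord j n).eventually_lt_const ?_
    beta_reduce
    rw [hφ0, (hZ j).tail n hn.1]
    norm_num
  have hne : ∀ᶠ ε in nhds 0, ∀ j k, j ≠ k → φ j ε ≠ φ k ε ∧ φ j ε ≠ -φ k ε := by
    simp only [Filter.eventually_all]
    intro j k hjk
    have e1 : φ j 0 ≠ φ k 0 := fun h => (hdist j k hjk).1 (by rw [← hφ0, ← hφ0, h])
    have e2 : φ j 0 ≠ -φ k 0 := fun h =>
      (hdist j k hjk).2 (by rw [← hφ0, ← hφ0, h, extendByZero_neg])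
    filter_upwards [((hcont j).sub (hcont k)).eventually_ne (sub_ne_zero.2 e1),
      ((hcont j).sub (hcont k).neg).eventually_ne (sub_ne_zero.2 e2)] with ε h1 h2
    exact ⟨sub_ne_zero.1 h1, sub_ne_zero.1 h2⟩
  have hall := (Filter.eventually_all.2 hφsmooth).and ((Filter.eventually_all.2 hφzero).and
    (hlarge.and (hsmall.and (hne.and (eventually_mem_branch hMN hcomp hφ0 hφuniq 32 2)))))
  have hinv : ∀ᶠ E : ℝ in Filter.atTop, 100 ≤ E ∧ _ :=
    (Filter.eventually_ge_atTop 100).and (tendsto_inv_atTop_zero.eventually hall)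
  refine ⟨fun j E n => ((√E : ℝ) : ℂ) * extendByZero N (φ j E⁻¹) n, ?_⟩
  filter_upwards [Filter.eventually_forall_ge_atTop.2 hinv] with E₀ hE₀
  have hE := fun E (h : E₀ < E) => hE₀ E h.le
  have hmode := fun j E (h : E₀ < E) =>
    stationary_of_reducedMap hMN (hE E h).1 ((hE E h).2.2.1 j)
      (fun n h1 h2 => (hE E h).2.2.2.1 j n (Finset.mem_Icc.2 ⟨h1, h2⟩)) fun n h1 => by
        by_cases h2 : n ≤ N
        · exact (hE E h).2.2.2.2.1 j n (Finset.mem_Ioc.2 ⟨h1, h2⟩)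
        · rw [extendByZero_of_lt _ (by omega)]; norm_num
  refine ⟨⟨fun j E h => (hmode j E h).1, fun j n E h => ?_, fun j E h => (hmode j E h).2,
    fun j k hjk E h hg => ?_⟩, fun E h w hw hp => ?_⟩
  · have hE0 : E ≠ 0 := by linarith [(hE E h).1]
    have h1 : ContDiffAt ℝ ω (fun E : ℝ => ((√E : ℝ) : ℂ)) E :=
      Complex.ofRealCLM.contDiff.contDiffAt.comp E (Real.contDiffAt_sqrt hE0)
    have h2 : ContDiffAt ℝ ω (fun E : ℝ => extendByZero N (φ j E⁻¹) n) E :=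
      (contDiff_extendByZero N n).contDiffAt.comp E
        (((hE E h).2.1 j).comp E (contDiffAt_inv ℝ hE0))
    exact ((h1.mul h2).of_le (by simp)).contDiffWithinAt
  · have hs : ((√E : ℝ) : ℂ) ≠ 0 := by
      exact_mod_cast (Real.sqrt_pos.2 (by linarith [(hE E h).1])).ne'
    have hk : extendByZero N (φ k E⁻¹) 1 ≠ 0 := fun h0 => by
      have := (hE E h).2.2.2.1 k 1 (Finset.mem_Icc.2 ⟨le_rfl, hM⟩)
      rw [h0] at this
      norm_num at this
    have hd := (hE E h).2.2.2.2.2.1 j k hjk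
    rcases eq_or_eq_neg_of_gaugeEquiv (hM.trans hMN) (hmode j E h).1 (hmode k E h).1 hg
      (mul_ne_zero hs hk) with e | e
    · refine hd.1 (extendByZero_injective N (funext fun n => ?_))
      exact mul_left_cancel₀ hs (congrFun e n)
    · refine hd.2 (extendByZero_injective N (funext fun n => ?_))
      rw [extendByZero_neg]
      apply mul_left_cancel₀ hs
      rw [mul_neg]
      exact congrFun e n
  · have hE100 := (hE E h).1
    have hE0 : 0 < E := by linarith
    have hs : ((√E : ℝ) : ℂ) ≠ 0 := by exact_mod_cast (Real.sqrt_pos.2 hE0).ne'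
    let v : Fin (N + 1) → ℂ := fun i => w i / ((√E : ℝ) : ℂ)
    have hv : extendByZero N v = fun n => w n / ((√E : ℝ) : ℂ) :=
      extendByZero_restrict (x := fun n => w n / ((√E : ℝ) : ℂ)) fun n hn => by simp [hw.2.1 n hn]
    have hwv : w = fun n => ((√E : ℝ) : ℂ) * extendByZero N v n := by
      funext n
      rw [hv]
      field_simp
    have hnorm : ∀ n, ‖w n‖ ^ 2 = E * ‖extendByZero N v n‖ ^ 2 := fun n => by
      rw [← norm_sq_sqrt_mul hE0.le, ← congrFun hwv n]
    have hst := hw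
    rw [hwv, isStationaryMode_smul_iff hE0] at hst
    -- The radius 2 suffices since |v_i|² ≤ 1 + 2 / E ≤ 4.
    have hmem : v ∈ Metric.closedBall (0 : Fin (N + 1) → ℂ) 2 := by
      rw [mem_closedBall_zero_iff, pi_norm_le_iff_of_nonneg (by norm_num)]
      intro i
      have := hw.normSq_le (by linarith) i
      rw [hnorm, extendByZero_apply] at this
      apply le_of_sq_le_sq _ (by norm_num)
      nlinarith
    obtain ⟨j, hj⟩ := (hE E h).2.2.2.2.2.2 v hmem
      (reducedMap_eq_zero_iff.2 fun n hn => reducedSystem_eq_zero_of_residual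
        (inv_ne_zero hE0.ne') (extendByZero_of_lt v (by omega)) hst.1 hst.2.2 hn)
      (fun n h1 h2 => by
        have := hp.1 n h1 h2
        rw [hnorm, show E * ‖extendByZero N v n‖ ^ 2 - E = E * (‖extendByZero N v n‖ ^ 2 - 1) by
          ring, abs_mul, abs_of_pos hE0] at this
        rw [← div_eq_mul_inv, le_div_iff₀ hE0]
        linarith)
      (fun n h1 => by
        by_cases h2 : n ≤ N
        · have := hp.2 n h1 h2
          rw [hnorm, le_div_iff₀ hE0] at this
          rw [inv_pow, ← div_eq_mul_inv, le_div_iff₀ (by positivity)]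
          linarith
        · rw [extendByZero_of_lt _ (by omega)]
          rw [norm_zero, zero_pow two_ne_zero]
          positivity)
    refine ⟨j, ?_⟩
    rcases hj with hj | hj
    · exact ⟨1, by simp, fun n _ _ => by rw [congrFun hwv n, hj, one_mul]⟩
    · exact ⟨-1, by simp, fun n _ _ => by rw [congrFun hwv n, hj, extendByZero_neg]; ring⟩

theorem mainTheorem4 (N : ℕ) (hN : 1 ≤ N) (γ : ℕ → ℝ)
    (hγ : ∀ K, 1 ≤ K → K ≤ N → |∑ n ∈ Finset.Icc K N, γ n| < 1)
    (hγ' : ∀ M K, 2 ≤ K → K ≤ M → M ≤ N → ∑ n ∈ Finset.Icc K M, γ n ≠ 0) :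
    ∃ E₀ C : ℝ, 0 < E₀ ∧ 0 < C ∧ ∃ u : (M : ℕ) → Fin (2 ^ M) → ℝ → ℕ → ℂ,
      (∀ M, 1 ≤ M → M ≤ N → PhaseCondition γ M → IsBranchSystem N γ M E₀ C (u M)) ∧
      ∀ E, E₀ < E → ∀ w : ℕ → ℂ, IsStationaryMode N γ E w → w ≠ 0 →
        ∃ M, 1 ≤ M ∧ M ≤ N ∧ HasProfile N M C E w ∧
          (∀ K, 1 ≤ K → K ≤ M → |∑ n ∈ Finset.Icc K M, γ n| ≤ 1) ∧
          (PhaseCondition γ M → ∃ j, GaugeEquiv N w (u M j E)) := by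
  have hbranch : ∀ M, ∃ u : Fin (2 ^ M) → ℝ → ℕ → ℂ, ∀ᶠ E₀ in Filter.atTop,
      1 ≤ M → M ≤ N → PhaseCondition γ M →
        IsBranchSystem N γ M E₀ 32 u ∧ ∀ E, E₀ < E → ∀ w, IsStationaryMode N γ E w →
          HasProfile N M 32 E w → ∃ j, GaugeEquiv N w (u j E) := by
    intro M
    by_cases h : 1 ≤ M ∧ M ≤ N ∧ PhaseCondition γ M
    · obtain ⟨u, hu⟩ := exists_branchSystem h.1 h.2.1 h.2.2
      exact ⟨u, hu.mono fun _ hu _ _ _ => hu⟩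
    · exact ⟨fun _ _ _ => 0, Filter.Eventually.of_forall fun _ h1 h2 h3 => absurd ⟨h1, h2, h3⟩ h⟩
  choose u hu using hbranch
  have hall := (Filter.eventually_all_finset (Finset.Icc 1 N)).2 fun M _ => hu M
  -- 16 bounds two boundary fluxes of at most 8 each; 10 = 2 + 8 collects the excess in E + 2 and
  -- one such flux. The sum of |γ n| times 4 is the error from replacing |w_n|² by E.
  have hgap := Filter.eventually_forall_ge_atTop.2 (eventually_gap hγ'
    (16 + 4 * ∑ n ∈ Finset.Icc 1 N, |γ n|) (10 + 4 * ∑ n ∈ Finset.Icc 1 N, |γ n|))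
  obtain ⟨E₀, hE₀, hE₁, hE₂⟩ := (hall.and (hgap.and (Filter.eventually_ge_atTop 2))).exists
  refine ⟨E₀, 32, by linarith, by norm_num, u, fun M h1 h2 h3 =>
    (hE₀ M (Finset.mem_Icc.2 ⟨h1, h2⟩) h1 h2 h3).1, fun E hE w hw h0 => ?_⟩
  obtain ⟨g1, g2⟩ := hE₁ E hE.le
  obtain ⟨M, h1, h2, hp, hs⟩ := hw.exists_profile h0 (by linarith) g1
    fun K M h1 h2 h3 h4 => by linarith [g2 K M h1 h2 h3 h4]
  exact ⟨M, h1, h2, hp, hs, fun h3 => (hE₀ M (Finset.mem_Icc.2 ⟨h1, h2⟩) h1 h2 h3).2 E hE w hw hp⟩
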